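/- Let $k$ be an algebraically closed field. A $k$-linear category is called *finite* if it is equivalent, as a $k$-linear category, to the category of finite-dimensional modules over some finite-dimensional $k$-algebra. A *finite multitensor category* is a finite $k$-linear category $\mathcal C$ with a rigid monoidal structure whose tensor product is $k$-bilinear on morphisms (the unit $\mathbf 1$ is not assumed to be simple). Its *distinguished object* is the end $D=\int_{a\in\mathcal C}\operatorname{Hom}_{\mathcal C}(a,\mathbf 1)\otimes a$, where $V\otimes a$ is the tensor product of a finite-dimensional vector space $V$ with the object $a$; $\mathcal C$ is called *unimodular* if $D\cong\mathbf 1$. A finite-dimensional $k$-algebra $A$ is *symmetric Frobenius* if it admits a non-degenerate symmetric bilinear form $\kappa$ with $\kappa(ab,c)=\kappa(a,bc)$, and a $k$-linear category is *symmetric Frobenius* if it is equivalent, as a $k$-linear category, to the category of finite-dimensional modules over a symmetric Frobenius $k$-algebra. **Theorem.** Let $\mathcal C$ be a finite multitensor category over $k$. Then $\mathcal C$ is symmetric Frobenius if and only if $\mathcal C$ is unimodular and the double dual functor $(-)^{\vee\vee}\colon\mathcal C\to\mathcal C$ is naturally isomorphic to the identity functor as a linear functor (no compatibility with the monoidal structure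 is required). In particular, if $\mathcal C$ is pivotal, i.e. if there is a monoidal natural isomorphism $\mathrm{id}_{\mathcal C}\cong(-)^{\vee\vee}$, then $\mathcal C$ is symmetric Frobenius if and only if it is unimodular. -/

import Mathlib

open CategoryTheory MonoidalCategory Limits Opposite

universe w v u

noncomputable section

/-! ### Finite linear categories and symmetric Frobenius algebras -/

/-- `C` is equivalent, as a `k`-linear category, to the category of finite-dimensional left modules
over the finite-dimensional `k`-algebra `A`. (Over a finite-dimensional algebra the finitely
generated modules are exactly the finite-dimensional ones. Every finite-dimensional `k`-algebra and
every finite-dimensional module has an isomorphic copy in the universe of `k`.) -/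
def IsLinearEquivalentToModules (k : Type w) [Field k] (C : Type u) [Category.{v} C]
    [Preadditive C] [Linear k C] (A : Type w) [Ring A] [Algebra k A] : Prop :=
  ∃ E : C ≌ FGModuleCat.{w} A, E.functor.Additive ∧ E.functor.Linear k

/-- A `k`-linear category is finite if it is equivalent, as a `k`-linear category, to the category
of finite-dimensional modules over some finite-dimensional `k`-algebra. -/
def IsFiniteLinearCategory (k : Type w) [Field k] (C : Type u) [Category.{v} C]
    [Preadditive C] [Linear k C] : Prop :=
  ∃ (A : Type w) (_ : Ring A) (_ : Algebra k A),
    Module.Finite k A ∧ IsLinearEquivalentToModules k C A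

/-- A Frobenius form on a `k`-algebra is an invariant non-degenerate bilinear form; the algebra is
symmetric Frobenius if it is finite-dimensional and has a symmetric Frobenius form. -/
def IsSymmetricFrobeniusAlgebra (k : Type w) [Field k] (A : Type w) [Ring A] [Algebra k A] :
    Prop :=
  Module.Finite k A ∧
    ∃ κ : A →ₗ[k] A →ₗ[k] k,
      (∀ a b c : A, κ (a * b) c = κ a (b * c)) ∧
      (∀ a : A, (∀ b : A, κ a b = 0) → a = 0) ∧
      (∀ a b : A, κ a b = κ b a)

/-- A linear category is symmetric Frobenius if it is equivalent, as a linear category, to the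
category of modules over a symmetric Frobenius algebra. -/
def IsSymmetricFrobeniusCategory (k : Type w) [Field k] (C : Type u) [Category.{v} C]
    [Preadditive C] [Linear k C] : Prop :=
  ∃ (A : Type w) (_ : Ring A) (_ : Algebra k A),
    IsSymmetricFrobeniusAlgebra k A ∧ IsLinearEquivalentToModules k C A

/-! ### The distinguished object and unimodularity -/

/-- The bifunctor `(a, b) ↦ Hom(a, m) ⊗ b`, contravariant in `a` and covariant in `b`, where
`V ⊗ b` is the tensor product (copower) of the vector space `V` with the object `b`, i.e. the object
with `Hom(V ⊗ b, x) ≅ Hom_k(V, Hom(b, x))`, naturally in `x`. The universal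
linear map `V → Hom(b, V ⊗ b)` is `ι`. These data are unique up to unique isomorphism. -/
structure HomTensor (k : Type w) [Field k] {C : Type u} [Category.{v} C]
    [Preadditive C] [Linear k C] (m : C) where
  /-- the bifunctor `(a, b) ↦ Hom(a, m) ⊗ b` -/
  functor : Cᵒᵖ ⥤ C ⥤ C
  /-- the universal linear map `h ↦ (b ⟶ Hom(a, m) ⊗ b)` (informally `y ↦ h ⊗ y`) -/
  ι (a b : C) : (a ⟶ m) →ₗ[k] (b ⟶ (functor.obj (op a)).obj b)
  /-- universal property of the copower -/
  existsUnique_desc (a b x : C) (φ : (a ⟶ m) →ₗ[k] (b ⟶ x)) :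
    ∃! t : (functor.obj (op a)).obj b ⟶ x, ∀ h : a ⟶ m, ι a b h ≫ t = φ h
  /-- the functor acts on the second argument through `b` -/
  ι_map (a : C) {b b' : C} (g : b ⟶ b') (h : a ⟶ m) :
    ι a b h ≫ (functor.obj (op a)).map g = g ≫ ι a b' h
  /-- the functor acts on the first argument by precomposition on `Hom(a, m)` -/
  ι_app {a a' : C} (f : a ⟶ a') (b : C) (h : a' ⟶ m) :
    ι a' b h ≫ (functor.map f.op).app b = ι a b (f ≫ h)

/-- `D` is the end `∫_{a ∈ C} Hom(a, m) ⊗ a`, i.e. the value at `m` of the left exact (variant of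
the) Nakayama functor of `C`. -/
def IsLeftExactNakayamaValue (k : Type w) [Field k] {C : Type u} [Category.{v} C]
    [Preadditive C] [Linear k C] (m D : C) : Prop :=
  ∃ (T : HomTensor k m) (W : Wedge T.functor), Nonempty (IsLimit W) ∧ Nonempty (W.pt ≅ D)

/-- `D` is the distinguished object `∫_{a ∈ C} Hom(a, 𝟙) ⊗ a` of the linear monoidal category `C`;
it is determined up to isomorphism. -/
def IsDistinguishedObject (k : Type w) [Field k] {C : Type u} [Category.{v} C]
    [Preadditive C] [Linear k C] [MonoidalCategory C] (D : C) : Prop :=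
  IsLeftExactNakayamaValue k (𝟙_ C) D

/-- `C` is unimodular if its distinguished object is isomorphic to the monoidal unit. -/
def IsUnimodular (k : Type w) [Field k] (C : Type u) [Category.{v} C]
    [Preadditive C] [Linear k C] [MonoidalCategory C] : Prop :=
  ∃ D : C, IsDistinguishedObject k D ∧ Nonempty (D ≅ 𝟙_ C)

/-! ### The double dual functor and pivotal structures -/

/-- The (right) double dual functor `X ↦ X^∨∨`, `f ↦ f^∨∨`; the right dual `X^∨` comes with
`X^∨ ⊗ X ⟶ 𝟙` and `𝟙 ⟶ X ⊗ X^∨`. -/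
def doubleDual (C : Type u) [Category.{v} C] [MonoidalCategory C] [RigidCategory C] : C ⥤ C where
  obj X := (Xᘁ)ᘁ
  map f := (fᘁ)ᘁ
  map_id X := by simp
  map_comp f g := by simp [comp_rightAdjointMate]

/-- The canonical isomorphism `X^∨∨ ≅ Z` when `Y` is some right dual of `X` and `Z` some
right dual of `Y`. -/
def doubleDualUniq {C : Type u} [Category.{v} C] [MonoidalCategory C] [RigidCategory C]
    {X Y Z : C} (p : ExactPairing X Y) (q : ExactPairing Y Z) : (doubleDual C).obj X ≅ Z :=
  rightDualIso (X := (RightRigidCategory.rightDual X).rightDual)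
    (RightRigidCategory.rightDual (RightRigidCategory.rightDual X).rightDual).exact
    (@exactPairingCongrLeft C _ _ _ _ _ q
      (rightDualIso (RightRigidCategory.rightDual X).exact p))

/-- The canonical isomorphism `(X ⊗ Y)^∨∨ ≅ X^∨∨ ⊗ Y^∨∨`, coming from
`(X ⊗ Y)^∨ ≅ Y^∨ ⊗ X^∨` applied twice. -/
def doubleDualTensorIso {C : Type u} [Category.{v} C] [MonoidalCategory C] [RigidCategory C]
    (X Y : C) :
    (doubleDual C).obj (X ⊗ Y) ≅ (doubleDual C).obj X ⊗ (doubleDual C).obj Y :=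
  doubleDualUniq (Y := Yᘁ ⊗ Xᘁ) (Z := (Xᘁ)ᘁ ⊗ (Yᘁ)ᘁ) ExactPairing.tensor ExactPairing.tensor

/-- The canonical isomorphism `𝟙^∨∨ ≅ 𝟙`. -/
def doubleDualUnitIso (C : Type u) [Category.{v} C] [MonoidalCategory C] [RigidCategory C] :
    (doubleDual C).obj (𝟙_ C) ≅ 𝟙_ C :=
  doubleDualUniq (Y := 𝟙_ C) exactPairingUnit exactPairingUnit

/-- A pivotal structure on a rigid monoidal category: a monoidal natural isomorphism from the
identity functor to the double dual functor. -/
structure PivotalStructure (C : Type u) [Category.{v} C] [MonoidalCategory C]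
    [RigidCategory C] where
  /-- the underlying natural isomorphism -/
  iso : 𝟭 C ≅ doubleDual C
  tensor (X Y : C) :
    iso.hom.app (X ⊗ Y) ≫ (doubleDualTensorIso X Y).hom = iso.hom.app X ⊗ₘ iso.hom.app Y
  unit : iso.hom.app (𝟙_ C) ≫ (doubleDualUnitIso C).hom = 𝟙 (𝟙_ C)

end

/-!
The left exact Nakayama functor of a finite linear category `C` is `N m = ∫_a Hom(a, m) ⊗ a`, so the
distinguished object is `N 𝟙`. The theorem follows from two facts about `N`.

* `C` is symmetric Frobenius if and only if `N ≅ 𝟭` (`isSymmetricFrobeniusCategory_iff`); for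
  modules over `A` this reflects `N m = Hom_A(A^*, m)`.
* If `N 𝟙 ≅ 𝟙`, then `N` is the double dual functor (`nakayamaStructureDoubleDual`).

If `N ≅ 𝟭`, then `N 𝟙 ≅ 𝟙`, hence `N` is also the double dual functor, and this is isomorphic to
the identity. Conversely, `N 𝟙 ≅ 𝟙` makes `N` the double dual functor, and an isomorphism of the
latter with the identity gives `N ≅ 𝟭`.

Ends are handled through the functor they represent. As hom spaces are finite-dimensional,
`Hom(x, N m)` is the space of linear natural transformations `Hom(-, m)^* ⟶ Hom(x, -)`, called
Nakayama cones here; limiting wedges are the same as universal cones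
(`isLeftExactNakayamaValue_iff`).

For the double dual, the chain of adjunctions
`m^∨∨∨ ⊗ - ⊣ m^∨∨ ⊗ - ⊣ m^∨ ⊗ - ⊣ m ⊗ -` turns a universal cone over `𝟙` at `𝟙` into a
universal cone over `m` at `m^∨∨` (`NakayamaCone.IsUniversal.transport`).

For symmetric Frobenius algebras, let `P` be the object corresponding to the regular module. A
symmetric nondegenerate form on the algebra is a symmetric trace `t` on `End P` such that all
pairings `t (p ≫ h)` of `Hom(P, a)` with `Hom(a, P)` are perfect. Given `t`, the universal cone
sends `ξ : Hom(a, m)^*` to the morphism `f : m ⟶ a` with `t (q ≫ f ≫ h) = ξ (h ≫ q)`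
(`IsDenseObject.nonempty_nakayamaStructure`). Conversely, if `N ≅ 𝟭`, the component at `P` of the
universal cone over `P` is a map `(End P)^* → End P`. It is surjective, since the cone over the
injective object corresponding to `A^*` with components `Hom(a, A^*)^* ≅ Hom(P, a)` factors through
it. So it is bijective, and naturality in both variables makes the preimage of the identity a
symmetric nondegenerate trace (`IsPerfectTrace.exists_symmetric_form`).
-/

noncomputable section

/-! ### Nakayama cones -/

section NakayamaCone

variable (k : Type w) [Field k] {C : Type u} [Category.{v} C] [Preadditive C] [Linear k C]

/-- A linear natural transformation `Hom(-, m)^* ⟶ Hom(x, -)`. When the hom spaces are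
finite-dimensional, this is the same as a wedge with point `x` over the bifunctor
`(a, b) ↦ Hom(a, m) ⊗ b`, since `Hom(x, V ⊗ a) = Hom_k(V^*, Hom(x, a))` for finite-dimensional
`V`. -/
structure NakayamaCone (m x : C) where
  /-- the component of the transformation at an object -/
  app (a : C) : Module.Dual k (a ⟶ m) →ₗ[k] (x ⟶ a)
  naturality {a b : C} (f : a ⟶ b) (ξ : Module.Dual k (a ⟶ m)) :
    app b (ξ ∘ₗ Linear.leftComp k m f) = app a ξ ≫ f

namespace NakayamaCone

variable {k} {m m' n x y : C}

/-- The cone over `m` at `x` that a morphism `g : x ⟶ y` induces from a cone over `m` at `y`. -/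
def precomp (τ : NakayamaCone k m y) (g : x ⟶ y) : NakayamaCone k m x where
  app a := Linear.leftComp k a g ∘ₗ τ.app a
  naturality f ξ := by simp [τ.naturality]

@[simp]
lemma precomp_app (τ : NakayamaCone k m y) (g : x ⟶ y) (a : C) (ξ : Module.Dual k (a ⟶ m)) :
    (τ.precomp g).app a ξ = g ≫ τ.app a ξ := rfl

/-- A cone over `m` at `x` is universal if `x` represents `y ↦ NakayamaCone k m y` through it. In
that case `x` is the value at `m` of the left exact Nakayama functor. -/
def IsUniversal (τ : NakayamaCone k m x) : Prop :=
  ∀ (y : C) (σ : NakayamaCone k m y),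
    ∃! g : y ⟶ x, ∀ (a : C) (ξ : Module.Dual k (a ⟶ m)), g ≫ τ.app a ξ = σ.app a ξ

lemma IsUniversal.hom_ext {τ : NakayamaCone k m x} (hτ : τ.IsUniversal) {g h : y ⟶ x}
    (H : ∀ (a : C) (ξ : Module.Dual k (a ⟶ m)), g ≫ τ.app a ξ = h ≫ τ.app a ξ) : g = h :=
  (hτ y (τ.precomp h)).unique H fun _ _ => rfl

lemma IsUniversal.precomp {τ : NakayamaCone k m x} (hτ : τ.IsUniversal) (e : y ≅ x) :
    (τ.precomp e.hom).IsUniversal := by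
  intro z σ
  refine ((e.symm.homToEquiv (Z := z)).existsUnique_congr fun {g} => ?_).mp (hτ z σ)
  simp [Iso.homToEquiv]

/-- Points of two universal cones over the same object are isomorphic, compatibly with the
cones. -/
lemma IsUniversal.exists_iso {τ : NakayamaCone k m x} (hτ : τ.IsUniversal)
    {σ : NakayamaCone k m y} (hσ : σ.IsUniversal) :
    ∃ e : y ≅ x, ∀ (a : C) (ξ : Module.Dual k (a ⟶ m)), e.hom ≫ τ.app a ξ = σ.app a ξ := by
  obtain ⟨g, hg, -⟩ := hτ y σ
  obtain ⟨h, hh, -⟩ := hσ x τ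
  exact ⟨⟨g, h, hσ.hom_ext (by simp [hg, hh]), hτ.hom_ext (by simp [hg, hh])⟩, hg⟩

section Transport

variable {K L R : C ⥤ C}

/-- Let `L` be left adjoint to `R`. If `m` represents `a ↦ Hom(R a, n)`, then a cone over `n` at `z`
induces a cone over `m` at `L z`. -/
def transport [L.Additive] [L.Linear k] (adj : L ⊣ R)
    (S : ∀ a : C, (R.obj a ⟶ n) ≃ₗ[k] (a ⟶ m))
    (hS : ∀ {a b : C} (f : a ⟶ b) (h : R.obj b ⟶ n), S a (R.map f ≫ h) = f ≫ S b h)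
    {z : C} (ω : NakayamaCone k n z) : NakayamaCone k m (L.obj z) where
  app a := Linear.rightComp k (L.obj z) (adj.counit.app a) ∘ₗ L.mapLinearMap k ∘ₗ
    ω.app (R.obj a) ∘ₗ (S a).toLinearMap.dualMap
  naturality {a b} f ξ := by
    have h : (ξ ∘ₗ Linear.leftComp k m f) ∘ₗ (S b).toLinearMap =
        (ξ ∘ₗ (S a).toLinearMap) ∘ₗ Linear.leftComp k n (R.map f) := by
      ext h
      simp [hS]
    have h' := ω.naturality (R.map f) (ξ ∘ₗ (S a).toLinearMap)
    rw [← h] at h'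
    simp [LinearMap.dualMap_apply', h']

lemma transport_app [L.Additive] [L.Linear k] (adj : L ⊣ R)
    (S : ∀ a : C, (R.obj a ⟶ n) ≃ₗ[k] (a ⟶ m))
    (hS : ∀ {a b : C} (f : a ⟶ b) (h : R.obj b ⟶ n), S a (R.map f ≫ h) = f ≫ S b h)
    {z : C} (ω : NakayamaCone k n z) (a : C) (ξ : Module.Dual k (a ⟶ m)) :
    (ω.transport adj S hS).app a ξ =
      (adj.homEquiv z a).symm (ω.app (R.obj a) (ξ ∘ₗ (S a).toLinearMap)) := by
  simp [transport, Adjunction.homEquiv_counit, LinearMap.dualMap_apply']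

/-- If moreover `L` has a left adjoint `K`, then a cone over `m` at `x` induces a cone over `n` at
`K x`. -/
def transportInv [K.Additive] [K.Linear k] (adj : L ⊣ R) (adj' : K ⊣ L)
    (S : ∀ a : C, (R.obj a ⟶ n) ≃ₗ[k] (a ⟶ m))
    (hS : ∀ {a b : C} (f : a ⟶ b) (h : R.obj b ⟶ n), S a (R.map f ≫ h) = f ≫ S b h)
    (σ : NakayamaCone k m x) : NakayamaCone k n (K.obj x) where
  app b := Linear.rightComp k (K.obj x) (adj'.counit.app b) ∘ₗ K.mapLinearMap k ∘ₗ
    σ.app (L.obj b) ∘ₗ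
      (Linear.leftComp k n (adj.unit.app b) ∘ₗ (S (L.obj b)).symm.toLinearMap).dualMap
  naturality {a b} f η := by
    have h : (η ∘ₗ Linear.leftComp k n f) ∘ₗ Linear.leftComp k n (adj.unit.app b) ∘ₗ
          (S (L.obj b)).symm.toLinearMap =
        (η ∘ₗ Linear.leftComp k n (adj.unit.app a) ∘ₗ (S (L.obj a)).symm.toLinearMap) ∘ₗ
          Linear.leftComp k m (L.map f) := by
      ext h
      obtain ⟨h, rfl⟩ := (S (L.obj b)).surjective h
      simp [← hS]
    have h' := σ.naturality (L.map f)
      (η ∘ₗ Linear.leftComp k n (adj.unit.app a) ∘ₗ (S (L.obj a)).symm.toLinearMap)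
    rw [← h] at h'
    simp [LinearMap.dualMap_apply', h']

lemma transportInv_app [K.Additive] [K.Linear k] (adj : L ⊣ R) (adj' : K ⊣ L)
    (S : ∀ a : C, (R.obj a ⟶ n) ≃ₗ[k] (a ⟶ m))
    (hS : ∀ {a b : C} (f : a ⟶ b) (h : R.obj b ⟶ n), S a (R.map f ≫ h) = f ≫ S b h)
    (σ : NakayamaCone k m x) (b : C) (η : Module.Dual k (b ⟶ n)) :
    (σ.transportInv adj adj' S hS).app b η = (adj'.homEquiv x b).symm (σ.app (L.obj b)
      (η ∘ₗ Linear.leftComp k n (adj.unit.app b) ∘ₗ (S (L.obj b)).symm.toLinearMap)) := by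
  simp [transportInv, Adjunction.homEquiv_counit, LinearMap.dualMap_apply']

/-- Along a chain of adjunctions `K ⊣ L ⊣ R` such that `m` represents `Hom(R -, n)`, the Nakayama
functor sends `m` to the image under `L` of its value at `n`. -/
lemma IsUniversal.transport [K.Additive] [K.Linear k] [L.Additive] [L.Linear k]
    (adj : L ⊣ R) (adj' : K ⊣ L)
    (S : ∀ a : C, (R.obj a ⟶ n) ≃ₗ[k] (a ⟶ m))
    (hS : ∀ {a b : C} (f : a ⟶ b) (h : R.obj b ⟶ n), S a (R.map f ≫ h) = f ≫ S b h)
    {z : C} {ω : NakayamaCone k n z} (hω : ω.IsUniversal) :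
    (ω.transport adj S hS).IsUniversal := by
  intro x σ
  refine ((adj'.homEquiv x z).existsUnique_congr fun {r} => ?_).mp
    (hω _ (σ.transportInv adj adj' S hS))
  constructor
  · intro H a ξ
    have h := congrArg (fun t => adj'.homEquiv _ _ t ≫ adj.counit.app a)
      (H (R.obj a) (ξ ∘ₗ (S a).toLinearMap))
    simp only [transportInv_app, Equiv.apply_symm_apply, ← σ.naturality,
      Adjunction.homEquiv_naturality_right] at h
    rw [transport_app, Adjunction.homEquiv_counit, ← Category.assoc, h]
    congr 1
    ext h
    obtain ⟨h, rfl⟩ := (S a).surjective h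
    simp [← hS]
  · intro H b η
    have h := H (L.obj b)
      (η ∘ₗ Linear.leftComp k n (adj.unit.app b) ∘ₗ (S (L.obj b)).symm.toLinearMap)
    have e : (η ∘ₗ Linear.leftComp k n (adj.unit.app b) ∘ₗ (S (L.obj b)).symm.toLinearMap) ∘ₗ
        (S (L.obj b)).toLinearMap = η ∘ₗ Linear.leftComp k n (adj.unit.app b) := by
      ext
      simp
    rw [transport_app, e, ω.naturality, Adjunction.homEquiv_counit] at h
    rw [transportInv_app, ← h, Equiv.eq_symm_apply, Adjunction.homEquiv_naturality_right]
    simp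

end Transport

end NakayamaCone

end NakayamaCone

/-! ### The distinguished object through Nakayama cones -/

namespace HomTensor

variable {k : Type w} [Field k] {C : Type u} [Category.{v} C] [Preadditive C] [Linear k C] {m : C}

lemma hom_ext (T : HomTensor k m) {a b x : C} {s t : (T.functor.obj (op a)).obj b ⟶ x}
    (H : ∀ h, T.ι a b h ≫ s = T.ι a b h ≫ t) : s = t :=
  (T.existsUnique_desc a b x (Linear.rightComp k b t ∘ₗ T.ι a b)).unique H fun _ => rfl

/-- The morphism `Hom(a, m) ⊗ b ⟶ b` given by a functional on `Hom(a, m)`. -/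
def contract (T : HomTensor k m) (a b : C) (ξ : Module.Dual k (a ⟶ m)) :
    (T.functor.obj (op a)).obj b ⟶ b :=
  (T.existsUnique_desc a b b (ξ.smulRight (𝟙 b))).choose

@[simp]
lemma ι_contract (T : HomTensor k m) (a b : C) (ξ : Module.Dual k (a ⟶ m)) (h : a ⟶ m) :
    T.ι a b h ≫ T.contract a b ξ = ξ h • 𝟙 b :=
  (T.existsUnique_desc a b b (ξ.smulRight (𝟙 b))).choose_spec.1 h

@[simp]
lemma ι_contract_assoc (T : HomTensor k m) (a b : C) (ξ : Module.Dual k (a ⟶ m)) (h : a ⟶ m)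
    {x : C} (g : b ⟶ x) : T.ι a b h ≫ T.contract a b ξ ≫ g = (ξ h • 𝟙 b) ≫ g := by
  rw [← Category.assoc, ι_contract]

lemma map_contract (T : HomTensor k m) (a : C) {b b' : C} (f : b ⟶ b')
    (ξ : Module.Dual k (a ⟶ m)) :
    (T.functor.obj (op a)).map f ≫ T.contract a b' ξ = T.contract a b ξ ≫ f :=
  T.hom_ext fun h => by
    rw [← Category.assoc, T.ι_map, Category.assoc, ι_contract, ι_contract_assoc]
    simp

lemma map_app_contract (T : HomTensor k m) {a a' : C} (f : a ⟶ a') (b : C)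
    (ξ : Module.Dual k (a ⟶ m)) :
    (T.functor.map f.op).app b ≫ T.contract a b ξ =
      T.contract a' b (ξ ∘ₗ Linear.leftComp k m f) :=
  T.hom_ext fun h => by
    rw [← Category.assoc, T.ι_app, ι_contract, ι_contract]
    simp

/-- The morphism `x ⟶ Hom(a, m) ⊗ b` corresponding to a linear map `Hom(a, m)^* → Hom(x, b)`. -/
def coext (T : HomTensor k m) {a b x : C} [FiniteDimensional k (a ⟶ m)]
    (σ : Module.Dual k (a ⟶ m) →ₗ[k] (x ⟶ b)) : x ⟶ (T.functor.obj (op a)).obj b :=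
  ∑ i, σ ((Module.finBasis k (a ⟶ m)).coord i) ≫ T.ι a b (Module.finBasis k (a ⟶ m) i)

@[simp]
lemma coext_contract (T : HomTensor k m) {a b x : C} [FiniteDimensional k (a ⟶ m)]
    (σ : Module.Dual k (a ⟶ m) →ₗ[k] (x ⟶ b)) (ξ : Module.Dual k (a ⟶ m)) :
    T.coext σ ≫ T.contract a b ξ = σ ξ := by
  simp only [coext, Preadditive.sum_comp, Category.assoc, ι_contract, Linear.comp_smul,
    Category.comp_id, ← map_smul, ← map_sum]
  congr 1
  exact (Module.finBasis k (a ⟶ m)).sum_dual_apply_smul_coord ξ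

/-- For finite-dimensional `Hom(a, m)`, a morphism into the copower `Hom(a, m) ⊗ b` is determined by
its contractions: the copower is also a power by the dual space. -/
lemma hom_ext_contract (T : HomTensor k m) {a b x : C} [FiniteDimensional k (a ⟶ m)]
    {s t : x ⟶ (T.functor.obj (op a)).obj b}
    (H : ∀ ξ, s ≫ T.contract a b ξ = t ≫ T.contract a b ξ) : s = t := by
  have e : 𝟙 ((T.functor.obj (op a)).obj b) =
      ∑ i, T.contract a b ((Module.finBasis k (a ⟶ m)).coord i) ≫
        T.ι a b (Module.finBasis k (a ⟶ m) i) := by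
    refine T.hom_ext fun h => ?_
    simp only [Preadditive.comp_sum, ι_contract_assoc, Linear.smul_comp, Category.id_comp,
      Category.comp_id, ← map_smul, ← map_sum]
    congr 1
    exact ((Module.finBasis k (a ⟶ m)).sum_repr h).symm
  rw [← Category.comp_id s, ← Category.comp_id t, e]
  simp only [Preadditive.comp_sum, ← Category.assoc, H]

/-- The Nakayama cone corresponding to the legs of a wedge over `(a, b) ↦ Hom(a, m) ⊗ b`. -/
def coneOfLegs (T : HomTensor k m) {x : C}
    (π : ∀ a : C, x ⟶ (T.functor.obj (op a)).obj a)
    (hπ : ∀ {a b : C} (f : a ⟶ b),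
      π a ≫ (T.functor.obj (op a)).map f = π b ≫ (T.functor.map f.op).app b) :
    NakayamaCone k m x where
  app a :=
    { toFun ξ := π a ≫ T.contract a a ξ
      map_add' ξ η := by
        rw [← Preadditive.comp_add]
        congr 1
        exact T.hom_ext fun h => by simp [add_smul]
      map_smul' c ξ := by
        rw [RingHom.id_apply, ← Linear.comp_smul]
        congr 1
        exact T.hom_ext fun h => by simp [mul_smul] }
  naturality {a b} f ξ := by
    change π b ≫ T.contract b b (ξ ∘ₗ Linear.leftComp k m f) = (π a ≫ T.contract a a ξ) ≫ f
    rw [← T.map_app_contract, ← Category.assoc, ← hπ f, Category.assoc, T.map_contract,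
      Category.assoc]

/-- The Nakayama cone corresponding to a wedge over `(a, b) ↦ Hom(a, m) ⊗ b`. -/
def coneOfWedge (T : HomTensor k m) (W : Wedge T.functor) : NakayamaCone k m W.pt :=
  T.coneOfLegs (fun a => W.ι a) fun f => W.condition f

lemma coext_app_condition [∀ a b : C, FiniteDimensional k (a ⟶ b)] (T : HomTensor k m) {x : C}
    (σ : NakayamaCone k m x) ⦃a b : C⦄ (f : a ⟶ b) :
    T.coext (σ.app a) ≫ (T.functor.obj (op a)).map f =
      T.coext (σ.app b) ≫ (T.functor.map f.op).app b :=
  T.hom_ext_contract fun ξ => by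
    rw [Category.assoc, Category.assoc, T.map_contract, T.map_app_contract, coext_contract,
      σ.naturality, ← T.coext_contract (σ.app a) ξ, Category.assoc]

/-- The wedge over `(a, b) ↦ Hom(a, m) ⊗ b` corresponding to a Nakayama cone. -/
def wedgeOfCone [∀ a b : C, FiniteDimensional k (a ⟶ b)] (T : HomTensor k m) {x : C}
    (σ : NakayamaCone k m x) : Wedge T.functor :=
  Wedge.mk x (fun a => T.coext (σ.app a)) (T.coext_app_condition σ)

/-- A limiting wedge corresponds to a universal cone. -/
lemma isUniversal_coneOfWedge [∀ a b : C, FiniteDimensional k (a ⟶ b)] (T : HomTensor k m)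
    {W : Wedge T.functor} (hW : IsLimit W) : (T.coneOfWedge W).IsUniversal := by
  intro y σ
  refine ⟨Wedge.IsLimit.lift hW (fun a => T.coext (σ.app a)) (T.coext_app_condition σ), ?_, ?_⟩
  · intro a ξ
    have h := Wedge.IsLimit.lift_ι hW (fun a => T.coext (σ.app a)) (T.coext_app_condition σ) a
    exact (Category.assoc _ _ _).symm.trans
      ((congrArg (· ≫ T.contract a a ξ) h).trans (T.coext_contract _ _))
  · intro g hg
    refine Wedge.IsLimit.hom_ext hW fun (a : C) => T.hom_ext_contract fun ξ => ?_
    have h := Wedge.IsLimit.lift_ι hW (fun a => T.coext (σ.app a)) (T.coext_app_condition σ) a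
    exact (Category.assoc _ _ _).trans ((hg a ξ).trans
      ((T.coext_contract _ _).symm.trans (congrArg (· ≫ T.contract a a ξ) h.symm)))

/-- A universal cone corresponds to a limiting wedge. -/
lemma nonempty_isLimit_wedgeOfCone [∀ a b : C, FiniteDimensional k (a ⟶ b)] (T : HomTensor k m)
    {x : C} {τ : NakayamaCone k m x} (hτ : τ.IsUniversal) :
    Nonempty (IsLimit (T.wedgeOfCone τ)) := by
  choose lift hlift using fun W : Wedge T.functor => (hτ _ (T.coneOfWedge W)).exists
  have key {y : C} (g : y ⟶ x) (a : C) (ξ : Module.Dual k (a ⟶ m)) :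
      (g ≫ T.coext (τ.app a)) ≫ T.contract a a ξ = g ≫ τ.app a ξ := by
    rw [Category.assoc, coext_contract]
  refine ⟨Multifork.IsLimit.mk _ (fun W => lift W) (fun W (a : C) => ?_) fun W g hg => ?_⟩
  · exact T.hom_ext_contract (a := a) fun ξ => (key (lift W) a ξ).trans (hlift W a ξ)
  · refine hτ.hom_ext fun a ξ => (key g a ξ).symm.trans (Eq.trans ?_ (hlift W a ξ).symm)
    exact congrArg (· ≫ T.contract a a ξ) (hg a)

end HomTensor

section Copower

variable (k : Type w) [Field k] {C : Type u} [Category.{v} C] [Preadditive C] [Linear k C]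

/-- In a linear category with finite coproducts, copowers by finite-dimensional vector spaces are
finite coproducts indexed by a basis. -/
lemma exists_copower [HasFiniteCoproducts C] (V : Type*) [AddCommGroup V] [Module k V]
    [FiniteDimensional k V] (b : C) :
    ∃ (T : C) (ι : V →ₗ[k] (b ⟶ T)), ∀ (x : C) (φ : V →ₗ[k] (b ⟶ x)),
      ∃! t : T ⟶ x, ∀ h, ι h ≫ t = φ h := by
  let B := Module.finBasis k V
  refine ⟨∐ fun _ : Fin (Module.finrank k V) => b,
    B.constr k fun i => Sigma.ι (fun _ : Fin (Module.finrank k V) => b) i, fun x φ => ?_⟩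
  refine ⟨Sigma.desc fun i => φ (B i), fun h => ?_, fun t ht => ?_⟩
  · suffices H : Linear.rightComp k b (Sigma.desc fun i => φ (B i)) ∘ₗ
        (B.constr k fun i => Sigma.ι (fun _ : Fin (Module.finrank k V) => b) i) = φ from
      LinearMap.congr_fun H h
    refine B.ext fun i => ?_
    simp
  · refine Sigma.hom_ext _ _ fun i => ?_
    rw [Sigma.ι_desc, ← ht, Module.Basis.constr_basis]

lemma nonempty_homTensor [HasFiniteCoproducts C] [∀ a b : C, FiniteDimensional k (a ⟶ b)]
    (m : C) : Nonempty (HomTensor k m) := by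
  choose T ι hT using fun a b : C => exists_copower k (a ⟶ m) b
  have ext {a b x : C} {s t : T a b ⟶ x} (H : ∀ h, ι a b h ≫ s = ι a b h ≫ t) : s = t :=
    (hT a b x (Linear.rightComp k b t ∘ₗ ι a b)).unique H fun _ => rfl
  -- Both functorial actions come from the universal property at once.
  choose act hact using fun (a a' b b' : C) (f : a ⟶ a') (g : b ⟶ b') =>
    (hT a' b (T a b') (Linear.leftComp k _ g ∘ₗ ι a b' ∘ₗ Linear.leftComp k m f)).exists
  simp only [LinearMap.comp_apply, Linear.leftComp_apply] at hact
  have act_id (a b : C) : act a a b b (𝟙 a) (𝟙 b) = 𝟙 (T a b) := ext fun h => by simp [hact]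
  have act_comp {a a' a'' b b' b'' : C} (f : a ⟶ a') (f' : a' ⟶ a'') (g : b ⟶ b')
      (g' : b' ⟶ b'') : act a' a'' b b' f' g ≫ act a a' b' b'' f g' =
        act a a'' b b'' (f ≫ f') (g ≫ g') := ext fun h => by
    rw [← Category.assoc, hact, Category.assoc, hact, hact, Category.assoc, Category.assoc]
  exact ⟨{
    functor :=
      { obj a :=
          { obj b := T a.unop b
            map g := act _ _ _ _ (𝟙 _) g
            map_id b := act_id _ _
            map_comp g g' := by rw [act_comp, Category.comp_id] }
        map {a a'} f :=
          { app b := act _ _ _ _ f.unop (𝟙 b)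
            naturality b b' g := by
              rw [act_comp, act_comp]
              simp }
        map_id a := by
          ext b
          exact act_id _ _
        map_comp f g := by
          ext b
          simp [act_comp] }
    ι := ι
    existsUnique_desc := hT
    ι_map a b b' g h := by simp [hact]
    ι_app f b h := by simp [hact] }⟩

end Copower

section Unimodular

variable (k : Type w) [Field k] {C : Type u} [Category.{v} C] [Preadditive C] [Linear k C]

lemma isLeftExactNakayamaValue_iff [HasFiniteCoproducts C]
    [∀ a b : C, FiniteDimensional k (a ⟶ b)] (m x : C) :
    IsLeftExactNakayamaValue k m x ↔ ∃ τ : NakayamaCone k m x, τ.IsUniversal := by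
  constructor
  · rintro ⟨T, W, ⟨hW⟩, ⟨e⟩⟩
    exact ⟨_, (T.isUniversal_coneOfWedge hW).precomp e.symm⟩
  · rintro ⟨τ, hτ⟩
    obtain ⟨T⟩ := nonempty_homTensor k m
    exact ⟨T, T.wedgeOfCone τ, T.nonempty_isLimit_wedgeOfCone hτ, ⟨Iso.refl _⟩⟩

/-- A category is unimodular if and only if its Nakayama functor fixes the unit. -/
lemma isUnimodular_iff [MonoidalCategory C] [HasFiniteCoproducts C]
    [∀ a b : C, FiniteDimensional k (a ⟶ b)] :
    IsUnimodular k C ↔ ∃ ω : NakayamaCone k (𝟙_ C) (𝟙_ C), ω.IsUniversal := by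
  refine ⟨?_, fun h => ⟨𝟙_ C, (isLeftExactNakayamaValue_iff k _ _).mpr h, ⟨Iso.refl _⟩⟩⟩
  rintro ⟨D, hD, ⟨e⟩⟩
  obtain ⟨τ, hτ⟩ := (isLeftExactNakayamaValue_iff k _ _).mp hD
  exact ⟨_, hτ.precomp e.symm⟩

end Unimodular

/-! ### Nakayama functors -/

section NakayamaStructure

variable (k : Type w) [Field k] {C : Type u} [Category.{v} C] [Preadditive C] [Linear k C]

/-- A structure exhibiting the endofunctor `F` as the left exact Nakayama functor
`m ↦ ∫_a Hom(a, m) ⊗ a`: universal Nakayama cones over all objects `m` at `F m` that are natural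
in `m`. -/
structure NakayamaStructure (F : C ⥤ C) where
  /-- the universal cone over an object -/
  cone (m : C) : NakayamaCone k m (F.obj m)
  isUniversal (m : C) : (cone m).IsUniversal
  map_comp {m m' : C} (f : m ⟶ m') (a : C) (ξ : Module.Dual k (a ⟶ m')) :
    F.map f ≫ (cone m').app a ξ = (cone m).app a (ξ ∘ₗ Linear.rightComp k a f)

variable {k}

namespace NakayamaStructure

/-- The property of being a Nakayama functor is invariant under natural isomorphism. -/
def ofIso {F G : C ⥤ C} (N : NakayamaStructure k F) (e : G ≅ F) : NakayamaStructure k G where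
  cone m := (N.cone m).precomp (e.app m).hom
  isUniversal m := (N.isUniversal m).precomp (e.app m)
  map_comp f a ξ := by simp [← N.map_comp]

lemma nonempty_iso {F G : C ⥤ C} (N : NakayamaStructure k F) (M : NakayamaStructure k G) :
    Nonempty (G ≅ F) := by
  choose e he using fun m => (N.isUniversal m).exists_iso (M.isUniversal m)
  refine ⟨NatIso.ofComponents e fun {m m'} f => (N.isUniversal m').hom_ext fun a ξ => ?_⟩
  rw [Category.assoc, Category.assoc, he, M.map_comp, N.map_comp, he]

end NakayamaStructure

end NakayamaStructure

section DoubleDual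

lemma tensorLeftHomEquiv_symm_comp_whiskerRight {C : Type u} [Category.{v} C]
    [MonoidalCategory C] {X Y : C} [HasRightDual X] [HasRightDual Y]
    (f : X ⟶ Y) {a b : C} (u : a ⟶ X ⊗ b) :
    (tensorLeftHomEquiv a Y Yᘁ b).symm (u ≫ f ▷ b) =
      fᘁ ▷ a ≫ (tensorLeftHomEquiv a X Xᘁ b).symm u := by
  change Yᘁ ◁ (u ≫ f ▷ b) ≫ (α_ _ _ _).inv ≫ ε_ _ _ ▷ _ ≫ (λ_ _).hom =
    fᘁ ▷ a ≫ Xᘁ ◁ u ≫ (α_ _ _ _).inv ≫ ε_ _ _ ▷ _ ≫ (λ_ _).hom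
  rw [← whisker_exchange_assoc, associator_inv_naturality_left_assoc, ← comp_whiskerRight_assoc,
    rightAdjointMate_comp_evaluation]
  simp

variable {k : Type w} [Field k] {C : Type u} [Category.{v} C] [Preadditive C] [Linear k C]
  [MonoidalCategory C] [MonoidalPreadditive C] [MonoidalLinear k C]

/-- The linear bijection `Hom(m^∨ ⊗ a, 𝟙) ≃ Hom(a, m)`. -/
def homFromDualEquiv (k : Type w) [Field k] [Linear k C] [MonoidalLinear k C] (m : C)
    [HasRightDual m] (a : C) : (mᘁ ⊗ a ⟶ 𝟙_ C) ≃ₗ[k] (a ⟶ m) where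
  __ := (tensorLeftHomEquiv a m mᘁ (𝟙_ C)).trans (ρ_ m).homToEquiv
  map_add' f g := by simp [tensorLeftHomEquiv, Iso.homToEquiv]
  map_smul' c f := by simp [tensorLeftHomEquiv, Iso.homToEquiv]

lemma homFromDualEquiv_apply (m : C) [HasRightDual m] (a : C) (h : mᘁ ⊗ a ⟶ 𝟙_ C) :
    homFromDualEquiv k m a h = tensorLeftHomEquiv a m mᘁ (𝟙_ C) h ≫ (ρ_ m).hom := rfl

lemma homFromDualEquiv_naturality (m : C) [HasRightDual m] {a b : C} (f : a ⟶ b)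
    (h : mᘁ ⊗ b ⟶ 𝟙_ C) :
    homFromDualEquiv k m a (mᘁ ◁ f ≫ h) = f ≫ homFromDualEquiv k m b h := by
  obtain ⟨u, rfl⟩ := (tensorLeftHomEquiv b m mᘁ (𝟙_ C)).symm.surjective h
  rw [homFromDualEquiv_apply, homFromDualEquiv_apply, ← tensorLeftHomEquiv_symm_naturality]
  simp

lemma homFromDualEquiv_comp {m m' : C} [HasRightDual m] [HasRightDual m'] (f : m ⟶ m') (a : C)
    (h : mᘁ ⊗ a ⟶ 𝟙_ C) :
    homFromDualEquiv k m' a (fᘁ ▷ a ≫ h) = homFromDualEquiv k m a h ≫ f := by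
  obtain ⟨u, rfl⟩ := (tensorLeftHomEquiv a m mᘁ (𝟙_ C)).symm.surjective h
  rw [homFromDualEquiv_apply, homFromDualEquiv_apply, ← tensorLeftHomEquiv_symm_comp_whiskerRight]
  simp

variable [RigidCategory C]

/-- The cone over `m` at `m^∨∨` with components
`Hom(a, m)^* ≅ Hom(m^∨ ⊗ a, 𝟙)^* → Hom(𝟙, m^∨ ⊗ a) ≅ Hom(m^∨∨, a)`, where the middle map comes from
a cone over `𝟙` at `𝟙`. -/
def doubleDualCone (ω : NakayamaCone k (𝟙_ C) (𝟙_ C)) (m : C) : NakayamaCone k m (mᘁ)ᘁ :=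
  (ω.transport (tensorLeftAdjunction mᘁ (mᘁ)ᘁ) (homFromDualEquiv k m)
    (homFromDualEquiv_naturality m)).precomp (ρ_ ((mᘁ)ᘁ)).inv

lemma doubleDualCone_app (ω : NakayamaCone k (𝟙_ C) (𝟙_ C)) (m a : C)
    (ξ : Module.Dual k (a ⟶ m)) :
    (doubleDualCone ω m).app a ξ = (ρ_ ((mᘁ)ᘁ)).inv ≫ (tensorLeftHomEquiv _ mᘁ (mᘁ)ᘁ a).symm
      (ω.app (mᘁ ⊗ a) (ξ ∘ₗ (homFromDualEquiv k m a).toLinearMap)) := by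
  refine (congrArg ((ρ_ ((mᘁ)ᘁ)).inv ≫ ·) (NakayamaCone.transport_app
    (tensorLeftAdjunction mᘁ (mᘁ)ᘁ) (homFromDualEquiv k m) (homFromDualEquiv_naturality m)
    ω a ξ)).trans ?_
  simp [tensorLeftAdjunction]

lemma rightAdjointMate_comp_doubleDualCone (ω : NakayamaCone k (𝟙_ C) (𝟙_ C)) {m m' : C}
    (f : m ⟶ m') (a : C) (ξ : Module.Dual k (a ⟶ m')) :
    (fᘁ)ᘁ ≫ (doubleDualCone ω m').app a ξ =
      (doubleDualCone ω m).app a (ξ ∘ₗ Linear.rightComp k a f) := by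
  have e : (ξ ∘ₗ Linear.rightComp k a f) ∘ₗ (homFromDualEquiv k m a).toLinearMap =
      (ξ ∘ₗ (homFromDualEquiv k m' a).toLinearMap) ∘ₗ Linear.leftComp k _ (fᘁ ▷ a) := by
    ext h
    simp [homFromDualEquiv_comp]
  rw [doubleDualCone_app, doubleDualCone_app, e, ω.naturality,
    tensorLeftHomEquiv_symm_comp_whiskerRight]
  exact rightUnitor_inv_naturality_assoc ((fᘁ)ᘁ) _

lemma isUniversal_doubleDualCone {ω : NakayamaCone k (𝟙_ C) (𝟙_ C)} (hω : ω.IsUniversal) (m : C) :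
    (doubleDualCone ω m).IsUniversal := by
  have h := hω.transport (tensorLeftAdjunction mᘁ (mᘁ)ᘁ)
    (tensorLeftAdjunction (mᘁ)ᘁ (HasRightDual.rightDual ((mᘁ)ᘁ)))
    (homFromDualEquiv k m) (homFromDualEquiv_naturality m)
  exact h.precomp (ρ_ ((mᘁ)ᘁ)).symm

/-- If the Nakayama functor fixes the unit, it is the double dual functor. -/
def nakayamaStructureDoubleDual {ω : NakayamaCone k (𝟙_ C) (𝟙_ C)} (hω : ω.IsUniversal) :
    NakayamaStructure k (doubleDual C) where
  cone := doubleDualCone ω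
  isUniversal m := isUniversal_doubleDualCone hω m
  map_comp f a ξ := rightAdjointMate_comp_doubleDualCone ω f a ξ

end DoubleDual

/-! ### Traces and symmetric forms -/

section Trace

variable {k : Type w} [Field k] {C : Type u} [Category.{v} C] [Preadditive C] [Linear k C]
  {P J : C}

/-- A functional on `Hom(P, J)` is a perfect trace if the pairing
`Hom(P, a) × Hom(a, J) → Hom(P, J) → k` is nondegenerate on both sides for every object `a`. For
modules over an algebra `A`, with `P = A` and `J = A^*`, evaluation at `1` twice is an example. -/
def IsPerfectTrace (ε : (P ⟶ J) →ₗ[k] k) : Prop :=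
  (∀ (a : C) (p : P ⟶ a), (∀ h : a ⟶ J, ε (p ≫ h) = 0) → p = 0) ∧
    ∀ (a : C) (h : a ⟶ J), (∀ p : P ⟶ a, ε (p ≫ h) = 0) → h = 0

/-- The linear map `Hom(P, a) → Hom(a, J)^*` given by a functional on `Hom(P, J)`. -/
def traceForm (ε : (P ⟶ J) →ₗ[k] k) (a : C) : (P ⟶ a) →ₗ[k] Module.Dual k (a ⟶ J) :=
  LinearMap.mk₂ k (fun p h => ε (p ≫ h)) (by simp) (by simp) (by simp) (by simp)

namespace IsPerfectTrace

variable [∀ a b : C, FiniteDimensional k (a ⟶ b)]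

lemma bijective_traceForm {ε : (P ⟶ J) →ₗ[k] k} (hε : IsPerfectTrace ε) (a : C) :
    Function.Bijective (traceForm ε a) := by
  have h₁ : Function.Injective (traceForm ε a) :=
    (injective_iff_map_eq_zero _).mpr fun p hp => hε.1 a p fun h => LinearMap.congr_fun hp h
  have h₂ : Function.Injective (traceForm ε a).flip :=
    (injective_iff_map_eq_zero _).mpr fun h hh => hε.2 a h fun p => LinearMap.congr_fun hh p
  have e : Module.finrank k (P ⟶ a) = Module.finrank k (Module.Dual k (a ⟶ J)) := by
    refine le_antisymm (LinearMap.finrank_le_finrank_of_injective h₁) ?_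
    rw [Subspace.dual_finrank_eq, ← Subspace.dual_finrank_eq (V := (P ⟶ a))]
    exact LinearMap.finrank_le_finrank_of_injective h₂
  exact ⟨h₁, (LinearMap.injective_iff_surjective_of_finrank_eq_finrank e).mp h₁⟩

/-- For a perfect trace, `Hom(P, a) ≅ Hom(a, J)^*`. -/
def equiv {ε : (P ⟶ J) →ₗ[k] k} (hε : IsPerfectTrace ε) (a : C) :
    (P ⟶ a) ≃ₗ[k] Module.Dual k (a ⟶ J) :=
  LinearEquiv.ofBijective (traceForm ε a) (hε.bijective_traceForm a)

@[simp]
lemma equiv_apply {ε : (P ⟶ J) →ₗ[k] k} (hε : IsPerfectTrace ε) (a : C) (p : P ⟶ a)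
    (h : a ⟶ J) : hε.equiv a p h = ε (p ≫ h) := rfl

/-- A perfect trace on `Hom(P, J)` makes `P` the point of a cone over `J`, all of whose components
are bijective. -/
def cone {ε : (P ⟶ J) →ₗ[k] k} (hε : IsPerfectTrace ε) : NakayamaCone k J P where
  app a := (hε.equiv a).symm.toLinearMap
  naturality {a b} f ξ := by
    obtain ⟨p, rfl⟩ := (hε.equiv a).surjective ξ
    refine (LinearEquiv.symm_apply_eq _).mpr ?_
    ext h
    simp

/-- If the identity is a Nakayama functor and `Hom(P, J)` has a perfect trace, then `End P` has a
symmetric nondegenerate form. -/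
lemma exists_symmetric_form {ε : (P ⟶ J) →ₗ[k] k} (hε : IsPerfectTrace ε)
    (N : NakayamaStructure k (𝟭 C)) :
    ∃ t : (P ⟶ P) →ₗ[k] k, (∀ f g, t (f ≫ g) = t (g ≫ f)) ∧
      ∀ f : P ⟶ P, (∀ g : P ⟶ P, t (f ≫ g) = 0) → f = 0 := by
  let τ : Module.Dual k (P ⟶ P) →ₗ[k] (P ⟶ P) := (N.cone P).app P
  -- The bijective cone over `J` at `P` comes from some `g : P ⟶ J`; by naturality in `g` it
  -- factors through the cone over `P`.
  have hsurj : Function.Surjective τ := by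
    obtain ⟨g, hg, -⟩ := N.isUniversal J P hε.cone
    intro p
    refine ⟨hε.equiv P p ∘ₗ Linear.rightComp k P g, ?_⟩
    exact (N.map_comp g P (hε.equiv P p)).symm.trans
      ((hg P _).trans ((hε.equiv P).symm_apply_apply p))
  have hinj : Function.Injective τ :=
    (LinearMap.injective_iff_surjective_of_finrank_eq_finrank Subspace.dual_finrank_eq).mpr hsurj
  obtain ⟨t, ht⟩ := hsurj (𝟙 P)
  have hl (f : P ⟶ P) : τ (t ∘ₗ Linear.leftComp k P f) = f :=
    ((N.cone P).naturality f t).trans ((congrArg (· ≫ f) ht).trans (Category.id_comp f))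
  have hr (f : P ⟶ P) : τ (t ∘ₗ Linear.rightComp k P f) = f :=
    (N.map_comp f P t).symm.trans ((congrArg (f ≫ ·) ht).trans (Category.comp_id f))
  refine ⟨t, fun f g => LinearMap.congr_fun (hinj ((hl f).trans (hr f).symm)) g, fun f hf => ?_⟩
  rw [← hl f, show t ∘ₗ Linear.leftComp k P f = 0 from LinearMap.ext hf, map_zero]

end IsPerfectTrace

variable (k) in
/-- The functor `Hom(P, -)` to modules over the endomorphisms of `P` is fully faithful. -/
structure IsDenseObject (P : C) : Prop where
  hom_ext {a b : C} {f g : a ⟶ b} : (∀ p : P ⟶ a, p ≫ f = p ≫ g) → f = g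
  exists_hom {a b : C} (t : (P ⟶ a) →ₗ[k] (P ⟶ b)) :
    (∀ (r : P ⟶ P) (p : P ⟶ a), t (r ≫ p) = r ≫ t p) → ∃ f : a ⟶ b, ∀ p, t p = p ≫ f

namespace IsDenseObject

variable {t : (P ⟶ P) →ₗ[k] k}

lemma hom_ext_trace (hP : IsDenseObject k P) (ht : IsPerfectTrace t) {a b : C} {f g : a ⟶ b}
    (H : ∀ (q : P ⟶ a) (h : b ⟶ P), t (q ≫ f ≫ h) = t (q ≫ g ≫ h)) : f = g := by
  refine hP.hom_ext fun q => sub_eq_zero.mp (ht.1 _ _ fun h => ?_)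
  rw [Preadditive.sub_comp, map_sub, Category.assoc, Category.assoc, H, sub_self]

variable [∀ a b : C, FiniteDimensional k (a ⟶ b)]

lemma exists_hom_trace (hP : IsDenseObject k P) (ht : IsPerfectTrace t)
    (hsymm : ∀ f g, t (f ≫ g) = t (g ≫ f)) (m a : C) (ξ : Module.Dual k (a ⟶ m)) :
    ∃ f : m ⟶ a, ∀ (q : P ⟶ m) (h : a ⟶ P), t (q ≫ f ≫ h) = ξ (h ≫ q) := by
  -- `s q` represents the functional `h ↦ ξ (h ≫ q)`.
  let s : (P ⟶ m) →ₗ[k] (P ⟶ a) := (ht.equiv a).symm.toLinearMap ∘ₗ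
    LinearMap.mk₂ k (fun q h => ξ (h ≫ q)) (by simp) (by simp) (by simp) (by simp)
  have hs (q : P ⟶ m) (h : a ⟶ P) : t (s q ≫ h) = ξ (h ≫ q) := by
    rw [← ht.equiv_apply]
    simp [s]
  obtain ⟨f, hf⟩ := hP.exists_hom s fun r q => (ht.equiv a).injective <| LinearMap.ext fun h => by
    rw [ht.equiv_apply, ht.equiv_apply, hs, Category.assoc, hsymm, Category.assoc, hs,
      Category.assoc]
  exact ⟨f, fun q h => by rw [← Category.assoc, ← hf, hs]⟩

/-- If `P` is dense and carries a symmetric perfect trace `t`, then the identity is a Nakayama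
functor. The universal cone sends `ξ` in `Hom(a, m)^*` to the morphism `f : m ⟶ a` with
`t (q ≫ f ≫ h) = ξ (h ≫ q)`. -/
lemma nonempty_nakayamaStructure (hP : IsDenseObject k P) (ht : IsPerfectTrace t)
    (hsymm : ∀ f g, t (f ≫ g) = t (g ≫ f)) : Nonempty (NakayamaStructure k (𝟭 C)) := by
  choose τ hτ using hP.exists_hom_trace ht hsymm
  let cone (m : C) : NakayamaCone k m m :=
    { app a :=
        { toFun ξ := τ m a ξ
          map_add' ξ η := hP.hom_ext_trace ht fun q h => by simp [hτ]
          map_smul' c ξ := hP.hom_ext_trace ht fun q h => by simp [hτ] }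
      naturality f ξ := hP.hom_ext_trace ht fun q h => by simp [hτ] }
  have hcone (m a : C) (ξ : Module.Dual k (a ⟶ m)) : (cone m).app a ξ = τ m a ξ := rfl
  refine ⟨⟨cone, fun m x σ => ?_, fun f a ξ => hP.hom_ext_trace ht fun q h => ?_⟩⟩
  · -- The morphism `x ⟶ m` is read off from the component of `σ` at `P`.
    let s : (P ⟶ x) →ₗ[k] (P ⟶ m) := (Module.evalEquiv k (P ⟶ m)).symm.toLinearMap ∘ₗ
      LinearMap.mk₂ k (fun p η => t (p ≫ σ.app P η)) (by simp) (by simp) (by simp) (by simp)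
    have hs (p : P ⟶ x) (η : Module.Dual k (P ⟶ m)) : η (s p) = t (p ≫ σ.app P η) := by
      simp [s]
    have hs' (r : P ⟶ P) (p : P ⟶ x) : s (r ≫ p) = r ≫ s p := by
      refine (Module.forall_dual_apply_eq_zero_iff k _).mp ?_ |> sub_eq_zero.mp
      intro η
      have h := hs p (η ∘ₗ Linear.leftComp k m r)
      rw [σ.naturality, ← Category.assoc, hsymm] at h
      simp only [LinearMap.comp_apply, Linear.leftComp_apply] at h
      rw [map_sub, hs, h, Category.assoc, sub_self]
    obtain ⟨g, hg⟩ := hP.exists_hom s hs'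
    refine ⟨g, fun a ξ => hP.hom_ext_trace ht fun q h => ?_, fun g' hg' => hP.hom_ext fun p => ?_⟩
    · have e := hs q (ξ ∘ₗ Linear.leftComp k m h)
      rw [σ.naturality, hg] at e
      rw [hcone, ← e]
      have := hτ m a ξ (q ≫ g) h
      simpa using this
    · refine (Module.forall_dual_apply_eq_zero_iff k _).mp ?_ |> sub_eq_zero.mp
      intro η
      have e := hτ m P η (p ≫ g') (𝟙 P)
      have e' := hg' P η
      rw [hcone] at e'
      rw [Category.comp_id, Category.assoc, e', Category.id_comp] at e
      rw [map_sub, ← hg, hs, e, sub_self]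
  · have e := hτ _ a ξ (q ≫ f) h
    rw [Category.assoc] at e
    simp [hcone, hτ, e]

end IsDenseObject

end Trace

/-! ### Transfer along linear equivalences -/

section Transfer

variable {k : Type w} [Field k] {C : Type u} [Category.{v} C] [Preadditive C] [Linear k C]
  {D : Type*} [Category* D] [Preadditive D] [Linear k D] (F : C ⥤ D) [F.Additive] [F.Linear k]

/-- Functionals on `Hom(P', J')` induce functionals on `Hom(P, J)` when `F P ≅ P'` and
`F J ≅ J'`. -/
def pullbackTrace {P J : C} {P' J' : D} (eP : F.obj P ≅ P') (eJ : F.obj J ≅ J')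
    (ε : (P' ⟶ J') →ₗ[k] k) : (P ⟶ J) →ₗ[k] k :=
  ε ∘ₗ Linear.leftComp k J' eP.inv ∘ₗ Linear.rightComp k (F.obj P) eJ.hom ∘ₗ F.mapLinearMap k

lemma pullbackTrace_apply {P J : C} {P' J' : D} (eP : F.obj P ≅ P') (eJ : F.obj J ≅ J')
    (ε : (P' ⟶ J') →ₗ[k] k) (f : P ⟶ J) :
    pullbackTrace F eP eJ ε f = ε (eP.inv ≫ F.map f ≫ eJ.hom) := rfl

lemma IsPerfectTrace.pullback [F.Full] [F.Faithful] {P J : C} {P' J' : D} (eP : F.obj P ≅ P')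
    (eJ : F.obj J ≅ J') {ε : (P' ⟶ J') →ₗ[k] k} (hε : IsPerfectTrace ε) :
    IsPerfectTrace (pullbackTrace F eP eJ ε) := by
  constructor
  · intro a p hp
    have h : eP.inv ≫ F.map p = 0 := hε.1 _ _ fun h => by
      obtain ⟨h', hh'⟩ := F.map_surjective (h ≫ eJ.inv)
      have := hp h'
      rw [pullbackTrace_apply, F.map_comp, hh'] at this
      simpa using this
    exact F.map_injective (by simpa using congrArg (eP.hom ≫ ·) h)
  · intro a h hh
    have e : F.map h ≫ eJ.hom = 0 := hε.2 _ _ fun p => by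
      obtain ⟨p', hp'⟩ := F.map_surjective (eP.hom ≫ p)
      have := hh p'
      rw [pullbackTrace_apply, F.map_comp, hp'] at this
      simpa using this
    exact F.map_injective (by simpa using congrArg (· ≫ eJ.inv) e)

lemma IsDenseObject.of_equivalence [F.Full] [F.Faithful] {P : C} {P' : D} (eP : F.obj P ≅ P')
    (hP' : IsDenseObject k P') : IsDenseObject k P := by
  constructor
  · intro a b f g H
    refine F.map_injective (hP'.hom_ext fun p => ?_)
    obtain ⟨p', hp'⟩ := F.map_surjective (eP.hom ≫ p)
    have := congrArg (fun f => eP.inv ≫ F.map f) (H p')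
    simpa [hp'] using this
  · intro a b t ht
    let G {a : C} : (P' ⟶ F.obj a) →ₗ[k] (P ⟶ a) :=
      { toFun p := F.preimage (eP.hom ≫ p)
        map_add' p q := F.map_injective (by simp)
        map_smul' c p := F.map_injective (by simp) }
    have hG {a : C} (p : P' ⟶ F.obj a) : F.map (G p) = eP.hom ≫ p := F.map_preimage _
    obtain ⟨f, hf⟩ := hP'.exists_hom
      (Linear.leftComp k (F.obj b) eP.inv ∘ₗ F.mapLinearMap k ∘ₗ t ∘ₗ G) fun r p => by
        obtain ⟨r', hr'⟩ := F.map_surjective (eP.hom ≫ r ≫ eP.inv)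
        have : G (r ≫ p) = r' ≫ G p := F.map_injective (by simp [hG, hr'])
        simp [this, ht, hr']
    obtain ⟨f', rfl⟩ := F.map_surjective f
    refine ⟨f', fun p => F.map_injective ?_⟩
    have h := hf (eP.inv ≫ F.map p)
    have hp : G (eP.inv ≫ F.map p) = p := F.map_injective (by simp [hG])
    simp only [LinearMap.comp_apply, hp, Linear.leftComp_apply, Category.assoc, cancel_epi] at h
    exact h.trans (F.map_comp p f').symm

lemma finiteDimensional_hom_of_faithful [F.Faithful]
    [∀ a b : D, FiniteDimensional k (a ⟶ b)] (a b : C) : FiniteDimensional k (a ⟶ b) :=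
  Module.Finite.of_injective (F.mapLinearMap k : (a ⟶ b) →ₗ[k] _) F.map_injective

end Transfer

/-! ### Modules over a finite-dimensional algebra -/

section RegularDual

variable (k : Type w) [Field k] (A : Type w) [Ring A] [Algebra k A]

/-- The dual space `A^*` of an algebra, as a left module over it: `(b • ζ) a = ζ (a * b)`. -/
def RegularDual : Type w := A →ₗ[k] k

namespace RegularDual

instance : AddCommGroup (RegularDual k A) := inferInstanceAs (AddCommGroup (A →ₗ[k] k))

instance : Module k (RegularDual k A) := inferInstanceAs (Module k (A →ₗ[k] k))

instance : FunLike (RegularDual k A) A k := inferInstanceAs (FunLike (A →ₗ[k] k) A k)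

variable {k A}

@[ext]
lemma ext {ζ η : RegularDual k A} (h : ∀ a, ζ a = η a) : ζ = η := LinearMap.ext h

instance : Module A (RegularDual k A) where
  smul b ζ := (show A →ₗ[k] k from ζ) ∘ₗ LinearMap.mulRight k b
  one_smul ζ := ext fun a => congrArg ζ (mul_one a)
  mul_smul b c ζ := ext fun a => congrArg ζ (mul_assoc a b c).symm
  smul_zero _ := rfl
  smul_add _ _ _ := rfl
  add_smul b c ζ := ext fun a => (congrArg ζ (mul_add a b c)).trans (LinearMap.map_add _ _ _)
  zero_smul ζ := ext fun a => (congrArg ζ (mul_zero a)).trans (LinearMap.map_zero _)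

instance : IsScalarTower k A (RegularDual k A) where
  smul_assoc c b ζ := ext fun a =>
    (congrArg ζ (mul_smul_comm c a b)).trans (LinearMap.map_smul _ _ _)

instance [Module.Finite k A] : Module.Finite A (RegularDual k A) := by
  have : Module.Finite k (RegularDual k A) := inferInstanceAs (Module.Finite k (A →ₗ[k] k))
  exact Module.Finite.of_restrictScalars_finite k A _

end RegularDual

end RegularDual

namespace FGModuleCat

variable {k : Type w} [Field k] {A : Type w} [Ring A] [Algebra k A]

lemma smul_hom_apply {M N : FGModuleCat.{w} A} (c : k) (f : M ⟶ N) (x : M) :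
    (c • f).hom.hom x = algebraMap k A c • f.hom.hom x := rfl

instance [Module.Finite k A] (M N : FGModuleCat.{w} A) : FiniteDimensional k (M ⟶ N) := by
  let _ : Module k M := Module.restrictScalars k A M
  let _ : Module k N := Module.restrictScalars k A N
  have : IsScalarTower k A M := IsScalarTower.restrictScalars k A M
  have : IsScalarTower k A N := IsScalarTower.restrictScalars k A N
  have : Module.Finite k M := Module.Finite.trans A M
  have : Module.Finite k N := Module.Finite.trans A N
  let j : (M ⟶ N) →ₗ[k] (M →ₗ[k] N) :=
    { toFun f := f.hom.hom.restrictScalars k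
      map_add' f g := rfl
      map_smul' c f := rfl }
  exact Module.Finite.of_injective j fun f g h =>
    FGModuleCat.hom_ext (LinearMap.ext fun x => LinearMap.congr_fun h x)

/-- The morphism from the regular module that sends `1` to a given element. -/
def ofElement {M : FGModuleCat.{w} A} (x : M) : FGModuleCat.of A A ⟶ M :=
  FGModuleCat.ofHom (W := M) (LinearMap.toSpanSingleton A M x)

lemma ofElement_one {M : FGModuleCat.{w} A} (x : M) : (ofElement x).hom.hom (1 : A) = x :=
  one_smul A x

lemma hom_apply_eq_smul {M : FGModuleCat.{w} A} (p : FGModuleCat.of A A ⟶ M) (a : A) :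
    p.hom.hom a = a • p.hom.hom (1 : A) := by
  rw [← map_smul, smul_eq_mul, mul_one]

lemma regular_hom_ext {M : FGModuleCat.{w} A} {p q : FGModuleCat.of A A ⟶ M}
    (h : p.hom.hom (1 : A) = q.hom.hom (1 : A)) : p = q :=
  FGModuleCat.hom_ext (LinearMap.ext fun a =>
    (hom_apply_eq_smul p a).trans ((congrArg (a • ·) h).trans (hom_apply_eq_smul q a).symm))

variable (k A) in
/-- Modules over `A` are modules over the endomorphisms of the regular module. -/
lemma isDenseObject_regular : IsDenseObject k (FGModuleCat.of A A) := by
  constructor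
  · intro M N f g H
    refine FGModuleCat.hom_ext (LinearMap.ext fun x => ?_)
    have h := congrArg (fun u => u.hom.hom (1 : A)) (H (ofElement x))
    change f.hom.hom ((ofElement x).hom.hom (1 : A)) =
      g.hom.hom ((ofElement x).hom.hom (1 : A)) at h
    rwa [ofElement_one] at h
  · intro M N t ht
    have hsmul (a : A) (x : M) : ofElement (a • x) = (ofElement (M := .of A A) a) ≫ ofElement x :=
      regular_hom_ext (by
        change (1 : A) • a • x = ((1 : A) • a) • x
        rw [one_smul, one_smul])
    have hadd (x y : M) : ofElement (x + y) = ofElement x + ofElement y :=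
      regular_hom_ext (by
        change (1 : A) • (x + y) = (1 : A) • x + (1 : A) • y
        simp)
    let f : M →ₗ[A] N :=
      { toFun x := (t (ofElement x)).hom.hom (1 : A)
        map_add' x y := by
          rw [hadd, map_add]
          rfl
        map_smul' a x := by
          rw [hsmul, ht, RingHom.id_apply, ← hom_apply_eq_smul]
          exact congrArg (t (ofElement x)).hom.hom (ofElement_one (M := .of A A) a) }
    refine ⟨⟨ModuleCat.ofHom f⟩, fun p => regular_hom_ext ?_⟩
    have hp : p = ofElement (p.hom.hom (1 : A)) := regular_hom_ext (ofElement_one _).symm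
    conv_lhs => rw [hp]
    rfl

variable (k A) in
/-- The functional `f ↦ f 1 1` on `Hom_A(A, A^*)`. -/
def evalOneOne [Module.Finite k A] :
    (FGModuleCat.of A A ⟶ FGModuleCat.of A (RegularDual k A)) →ₗ[k] k where
  toFun f := (f.hom.hom (1 : A) : RegularDual k A) (1 : A)
  map_add' f g := rfl
  map_smul' c f := by
    rw [smul_hom_apply, algebraMap_smul]
    rfl

lemma evalOneOne_apply [Module.Finite k A]
    (f : FGModuleCat.of A A ⟶ FGModuleCat.of A (RegularDual k A)) :
    evalOneOne k A f = (f.hom.hom (1 : A) : RegularDual k A) (1 : A) := rfl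

/-- The pairing of `M = Hom_A(A, M)` with `Hom_A(M, A^*)` is nondegenerate because the latter is
the dual space of `M`. -/
lemma isPerfectTrace_evalOneOne [Module.Finite k A] : IsPerfectTrace (evalOneOne k A) := by
  constructor
  · intro M p hp
    refine regular_hom_ext ?_
    let _ : Module k M := Module.restrictScalars k A M
    have : IsScalarTower k A M := IsScalarTower.restrictScalars k A M
    refine (Module.forall_dual_apply_eq_zero_iff k (p.hom.hom (1 : A))).mp fun ζ => ?_
    let h : M →ₗ[A] RegularDual k A :=
      { toFun x := ζ ∘ₗ (LinearMap.toSpanSingleton A M x).restrictScalars k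
        map_add' x y := RegularDual.ext fun a => by
          change ζ (a • (x + y)) = ζ (a • x) + ζ (a • y)
          rw [smul_add, map_add]
        map_smul' b x := RegularDual.ext fun a => by
          change ζ (a • b • x) = ζ ((a * b) • x)
          rw [mul_smul] }
    have := hp ⟨ModuleCat.ofHom h⟩
    change ζ ((1 : A) • p.hom.hom (1 : A)) = 0 at this
    rwa [one_smul] at this
  · intro M h hh
    refine FGModuleCat.hom_ext (LinearMap.ext fun x => RegularDual.ext fun a => ?_)
    have := hh (ofElement (a • x))
    rw [evalOneOne_apply] at this
    change (h.hom.hom ((1 : A) • a • x) : RegularDual k A) (1 : A) = 0 at this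
    rw [one_smul, map_smul] at this
    change (h.hom.hom x : RegularDual k A) (1 * a) = 0 at this
    rwa [one_mul] at this

end FGModuleCat

/-! ### Symmetric Frobenius categories -/

lemma hasFiniteCoproducts_of_equivalence {C : Type u} [Category.{v} C] {A : Type w} [Ring A]
    [IsNoetherianRing A] (E : C ≌ FGModuleCat.{w} A) : HasFiniteCoproducts C :=
  ⟨fun _ => Adjunction.hasColimitsOfShape_of_equivalence E.functor⟩

section SymmetricFrobenius

variable {k : Type w} [Field k] {C : Type u} [Category.{v} C] [Preadditive C] [Linear k C]
  {A : Type w} [Ring A] [Algebra k A]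

section RegularObject

variable (E : C ≌ FGModuleCat.{w} A)

/-- The object corresponding to the regular module. -/
def regularObject : C := E.inverse.obj (FGModuleCat.of A A)

/-- The counit of the equivalence at the regular module. -/
def regularObjectIso : E.functor.obj (regularObject E) ≅ FGModuleCat.of A A :=
  E.counitIso.app _

variable [E.functor.Additive] [E.functor.Linear k]

variable (k) in
/-- The linear map from the endomorphisms of the regular object to the algebra. -/
def regularEndHom : (regularObject E ⟶ regularObject E) →ₗ[k] A where
  toFun f := ((regularObjectIso E).inv ≫ E.functor.map f ≫ (regularObjectIso E).hom).hom.hom (1 : A)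
  map_add' f g := by
    rw [Functor.map_add, Preadditive.add_comp, Preadditive.comp_add]
    rfl
  map_smul' c f := by
    rw [Functor.map_smul, Linear.smul_comp, Linear.comp_smul, FGModuleCat.smul_hom_apply,
      algebraMap_smul]
    rfl

lemma regularEndHom_apply (f : regularObject E ⟶ regularObject E) :
    regularEndHom k E f =
      ((regularObjectIso E).inv ≫ E.functor.map f ≫ (regularObjectIso E).hom).hom.hom (1 : A) :=
  rfl

lemma bijective_regularEndHom : Function.Bijective (regularEndHom k E) := by
  constructor
  · intro f g h
    have h' := FGModuleCat.regular_hom_ext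
      (p := (regularObjectIso E).inv ≫ E.functor.map f ≫ (regularObjectIso E).hom)
      (q := (regularObjectIso E).inv ≫ E.functor.map g ≫ (regularObjectIso E).hom) h
    rw [Iso.cancel_iso_inv_left, Iso.cancel_iso_hom_right] at h'
    exact E.functor.map_injective h'
  · intro a
    obtain ⟨f, hf⟩ := E.functor.map_surjective ((regularObjectIso E).hom ≫
      FGModuleCat.ofElement (M := .of A A) a ≫ (regularObjectIso E).inv)
    refine ⟨f, ?_⟩
    rw [regularEndHom_apply, hf]
    simp only [Category.assoc, Iso.inv_hom_id, Category.comp_id, Iso.inv_hom_id_assoc]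
    exact FGModuleCat.ofElement_one (M := .of A A) a

variable (k) in
/-- The endomorphisms of the regular object are the elements of the algebra. Composition in
diagrammatic order corresponds to multiplication. -/
def regularEndEquiv : (regularObject E ⟶ regularObject E) ≃ₗ[k] A :=
  LinearEquiv.ofBijective (regularEndHom k E) (bijective_regularEndHom E)

lemma regularEndEquiv_apply (f : regularObject E ⟶ regularObject E) :
    regularEndEquiv k E f =
      ((regularObjectIso E).inv ≫ E.functor.map f ≫ (regularObjectIso E).hom).hom.hom (1 : A) :=
  rfl

lemma regularEndEquiv_comp (f g : regularObject E ⟶ regularObject E) :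
    regularEndEquiv k E (f ≫ g) = regularEndEquiv k E f * regularEndEquiv k E g := by
  have h : (regularObjectIso E).inv ≫ E.functor.map (f ≫ g) ≫ (regularObjectIso E).hom =
      ((regularObjectIso E).inv ≫ E.functor.map f ≫ (regularObjectIso E).hom) ≫
        (regularObjectIso E).inv ≫ E.functor.map g ≫ (regularObjectIso E).hom := by
    simp
  rw [regularEndEquiv_apply, h, regularEndEquiv_apply, regularEndEquiv_apply]
  exact FGModuleCat.hom_apply_eq_smul
    ((regularObjectIso E).inv ≫ E.functor.map g ≫ (regularObjectIso E).hom) _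

end RegularObject

/-- A symmetric Frobenius form on an algebra is an isomorphism of modules between the algebra and
its dual. -/
lemma exists_iso_regularDual [Module.Finite k A] {κ : A →ₗ[k] A →ₗ[k] k}
    (hκ : ∀ a b c : A, κ (a * b) c = κ a (b * c))
    (hκ' : ∀ a : A, (∀ b : A, κ a b = 0) → a = 0) (hsymm : ∀ a b : A, κ a b = κ b a) :
    ∃ e : FGModuleCat.of A A ≅ FGModuleCat.of A (RegularDual k A),
      ∀ a : A, FGModuleCat.evalOneOne k A (FGModuleCat.ofElement (M := .of A A) a ≫ e.hom) =
        κ 1 a := by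
  have hinj : Function.Injective κ := (injective_iff_map_eq_zero _).mpr fun a ha =>
    hκ' a fun b => LinearMap.congr_fun ha b
  have hbij : Function.Bijective κ := ⟨hinj,
    (LinearMap.injective_iff_surjective_of_finrank_eq_finrank
      Subspace.dual_finrank_eq.symm).mp hinj⟩
  let f : A →ₗ[A] RegularDual k A :=
    { toFun a := κ a
      map_add' a b := map_add κ a b
      map_smul' b a := RegularDual.ext fun c => by
        change κ (b * a) c = κ a (c * b)
        rw [hsymm, ← hκ, hsymm] }
  refine ⟨(LinearEquiv.ofBijective f hbij).toFGModuleCatIso, fun a => ?_⟩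
  change κ ((1 : A) * a) 1 = κ 1 a
  rw [one_mul, hsymm]

lemma nonempty_nakayamaStructure_of_symmetric (E : C ≌ FGModuleCat.{w} A)
    [E.functor.Additive] [E.functor.Linear k] (hA : IsSymmetricFrobeniusAlgebra k A) :
    Nonempty (NakayamaStructure k (𝟭 C)) := by
  obtain ⟨_, κ, hκ, hκ', hsymm⟩ := hA
  have := finiteDimensional_hom_of_faithful (k := k) E.functor
  obtain ⟨e, he⟩ := exists_iso_regularDual hκ hκ' hsymm
  refine ((FGModuleCat.isDenseObject_regular k A).of_equivalence E.functor
    (regularObjectIso E)).nonempty_nakayamaStructure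
      (FGModuleCat.isPerfectTrace_evalOneOne.pullback E.functor (regularObjectIso E)
        (regularObjectIso E ≪≫ e)) fun f g => ?_
  have key (f : regularObject E ⟶ regularObject E) :
      pullbackTrace E.functor (regularObjectIso E) (regularObjectIso E ≪≫ e)
        (FGModuleCat.evalOneOne k A) f = κ 1 (regularEndEquiv k E f) := by
    rw [← he, pullbackTrace_apply]
    congr 1
    rw [Iso.trans_hom, ← Category.assoc, ← Category.assoc, Category.assoc _ (E.functor.map f)]
    congr 1
    exact FGModuleCat.regular_hom_ext (FGModuleCat.ofElement_one (M := .of A A) _).symm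
  rw [key, key, regularEndEquiv_comp, regularEndEquiv_comp, ← hκ, ← hκ, one_mul, one_mul, hsymm]

lemma isSymmetricFrobeniusAlgebra_of_nakayamaStructure [Module.Finite k A]
    (E : C ≌ FGModuleCat.{w} A) [E.functor.Additive] [E.functor.Linear k]
    (N : NakayamaStructure k (𝟭 C)) : IsSymmetricFrobeniusAlgebra k A := by
  have := finiteDimensional_hom_of_faithful (k := k) E.functor
  obtain ⟨t, ht, ht'⟩ := ((FGModuleCat.isPerfectTrace_evalOneOne (k := k)).pullback E.functor
    (regularObjectIso E) (E.counitIso.app _)).exists_symmetric_form N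
  let Φ := regularEndEquiv k E
  have hΦ (a b : A) : Φ.symm (a * b) = Φ.symm a ≫ Φ.symm b := by
    rw [LinearEquiv.symm_apply_eq, regularEndEquiv_comp]
    exact congrArg₂ _ (Φ.apply_symm_apply a).symm (Φ.apply_symm_apply b).symm
  refine ⟨inferInstance, (LinearMap.mul k A).compr₂ (t ∘ₗ Φ.symm.toLinearMap), ?_, ?_, ?_⟩
  · intro a b c
    simp [mul_assoc]
  · intro a ha
    refine Φ.symm.map_eq_zero_iff.mp (ht' _ fun g => ?_)
    have := ha (Φ g)
    simpa [hΦ] using this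
  · intro a b
    simp [hΦ, ht]

variable (k C) in
/-- A finite linear category is symmetric Frobenius if and only if its Nakayama functor is
isomorphic to the identity. -/
lemma isSymmetricFrobeniusCategory_iff (hC : IsFiniteLinearCategory k C) :
    IsSymmetricFrobeniusCategory k C ↔ Nonempty (NakayamaStructure k (𝟭 C)) := by
  constructor
  · rintro ⟨A, _, _, hA, E, _, _⟩
    exact nonempty_nakayamaStructure_of_symmetric E hA
  · rintro ⟨N⟩
    obtain ⟨A, _, _, _, E, hE, hE'⟩ := hC
    exact ⟨A, _, _, isSymmetricFrobeniusAlgebra_of_nakayamaStructure E N, E, hE, hE'⟩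

end SymmetricFrobenius

end

theorem theorem4p10 (k : Type w) [Field k] [IsAlgClosed k]
    (C : Type u) [Category.{v} C] [Preadditive C] [Linear k C]
    [MonoidalCategory C] [MonoidalPreadditive C] [MonoidalLinear k C] [RigidCategory C]
    (hC : IsFiniteLinearCategory k C) :
    (IsSymmetricFrobeniusCategory k C ↔
      IsUnimodular k C ∧ Nonempty (doubleDual C ≅ 𝟭 C)) ∧
    (Nonempty (PivotalStructure C) →
      (IsSymmetricFrobeniusCategory k C ↔ IsUnimodular k C)) := by
  have main : IsSymmetricFrobeniusCategory k C ↔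
      IsUnimodular k C ∧ Nonempty (doubleDual C ≅ 𝟭 C) := by
    rw [isSymmetricFrobeniusCategory_iff k C hC]
    obtain ⟨A, _, _, _, E, _, _⟩ := hC
    have : IsNoetherianRing A := IsNoetherianRing.of_finite k A
    have := hasFiniteCoproducts_of_equivalence E
    have := finiteDimensional_hom_of_faithful (k := k) E.functor
    rw [isUnimodular_iff]
    constructor
    · rintro ⟨N⟩
      exact ⟨⟨_, N.isUniversal (𝟙_ C)⟩,
        N.nonempty_iso (nakayamaStructureDoubleDual (N.isUniversal (𝟙_ C)))⟩
    · rintro ⟨⟨ω, hω⟩, ⟨e⟩⟩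
      exact ⟨(nakayamaStructureDoubleDual hω).ofIso e.symm⟩
  exact ⟨main, fun ⟨p⟩ => main.trans (and_iff_left ⟨p.iso.symm⟩)⟩
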